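/- **Setting.** Let $\xi$ be a random vector on a probability space $(\Omega,\mathcal F,\mathcal P)$ with values in $\Xi\subseteq\mathbb R^d$; "a.e. $\xi\in\Xi$" refers to its law. Let $x_0\in\mathbb R^n$, and let $f:\mathbb R\times\mathbb R^n\times\mathbb R^m\times\Xi\to\mathbb R^n$, $g:\mathbb R\times\mathbb R^n\times\mathbb R^m\times\Xi\to\mathbb R$, $A:\Xi\to\mathbb R^{q\times n}$, $B:\Xi\to\mathbb R^{q\times m}$, $Q:\mathbb R\times\Xi\to\mathbb R^q$ be such that $f(t,\mathbf x,\mathbf y,\cdot)$, $g(t,\mathbf x,\mathbf y,\cdot)$, $A$, $B$, $Q(t,\cdot)$ are integrable for $t\ge 0$. With $$K(t,\mathbf x)=\{\mathbf y\in\mathbb R^m:\ \mathbb E[A(\xi)]\mathbf x+\mathbb E[B(\xi)]\mathbf y+\mathbb E[Q(t,\xi)]\le 0\},$$ let $\mathcal S(t,\mathbf x)$ be the set of minimizers of $\mathbb E[g(t,\mathbf x,\cdot,\xi)]$ over $K(t,\mathbf x)$. A pair $(x,y)$ is a *weak solution over $[0,T]$ of the original problem* if $x$ is absolutely continuous and $y$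 is integrable on $[0,T]$ and, for all $t\in[0,T]$, $y(t)\in\mathcal S(t,x(t))$ and $x(t)=x_0+\int_0^t\mathbb E[f(\tau,x(\tau),y(\tau),\xi)]\,d\tau$. Let $\xi_1,\xi_2,\dots$ be an i.i.d. sample of $\xi$ on $\Omega$. A pair $(x^\nu,y^\nu)\in C^1([0,T])\times C^0([0,T])$ *solves the SAA problem* on $[0,T]$ (for a given $\omega\in\Omega$) if $x^\nu(0)=x_0$ and, for all $t\in[0,T]$, $\dot x^\nu(t)=\frac1\nu\sum_{\ell=1}^\nu f(t,x^\nu(t),y^\nu(t),\xi_\ell)$ and $y^\nu(t)$ minimizes $\frac1\nu\sum_{\ell=1}^\nu g(t,x^\nu(t),\cdot,\xi_\ell)$ over $$K^\nu(t,x^\nu(t))=\Big\{\mathbf y:\ \tfrac1\nu\sum_{\ell=1}^\nu\big(A(\xi_\ell)x^\nu(t)+B(\xi_\ell)\mathbf y+Q(t,\xi_\ell)\big)\le 0\Big\}.$$ **Standing assumptions.** There are integrable $\kappa_f,\kappa_Q:\Xi\to[0,\infty)$ such that for a.e. $\xi\in\Xi$: $\|f(t_1,u_1,v_1,\xi)-f(t_2,u_2,v_2,\xi)\|\le\kappa_f(\xi)(|t_1-t_2|+\|u_1-u_2\|+\|v_1-v_2\|)$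 for all $t_1,t_2\ge0$, $u_1,u_2\in\mathbb R^n$, $v_1,v_2\in\mathbb R^m$; $\|Q(t,\xi)\|\le\kappa_Q(\xi)t$ for all $t\ge0$; $g(\cdot,\cdot,\cdot,\xi)$ and $Q(\cdot,\xi)$ are continuous. For all $t\ge0$ and $\mathbf x$, $g(t,\mathbf x,\cdot,\xi)$ is convex for a.e. $\xi$. On every bounded set of $(t,\mathbf x,\mathbf y)$ with $t\ge0$, $|g(t,\mathbf x,\mathbf y,\xi)|$ is dominated, for a.e. $\xi$, by an integrable function of $\xi$. **Theorem.** Assume in addition: 1. (strong convexity) there is an integrable $\varrho:\Xi\to(0,\infty)$ such that for all $t\ge0$, $\mathbf x\in\mathbb R^n$ and a.e. $\xi\in\Xi$, for all $\mathbf y_1,\mathbf y_2\in\mathbb R^m$, $\tau\in(0,1)$, $$g(t,\mathbf x,(1-\tau)\mathbf y_1+\tau\mathbf y_2,\xi)\le(1-\tau)g(t,\mathbf x,\mathbf y_1,\xi)+\tau g(t,\mathbf x,\mathbf y_2,\xi)-\tfrac12\varrho(\xi)\tau(1-\tau)\|\mathbf y_1-\mathbf y_2\|^2;$$ 2. $\operatorname{int}K(0,x_0)\ne\emptyset$;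 3. (nondegeneracy) for each $i$ such that the $i$-th row of $\mathbb E[B(\xi)]$ is zero and $\big(\mathbb E[A(\xi)]x_0+\mathbb E[Q(0,\xi)]\big)_i=0$, the $i$-th row of $B(\xi)$ is zero for a.e. $\xi\in\Xi$. (This holds, for example, if some $\mathbf y$ satisfies all the inequalities defining $K(0,x_0)$ strictly, or if $\mathbb E[B(\xi)]$ has no zero row.) Let $T^*>0$ and suppose that, with probability 1, for all sufficiently large $\nu$, $(x^\nu,y^\nu)\in C^1([0,T^*])\times C^0([0,T^*])$ solves the SAA problem on $[0,T^*]$. Then there is a (deterministic) $\bar T$ with $0<\bar T\le T^*$ such that, with probability 1, there are indices $\nu_1<\nu_2<\cdots$ and a pair $(x^*,y^*)$ (which may depend on the realization of the sample and of the solutions) such that $x^{\nu_k}\to x^*$ uniformly on $[0,\bar T]$, $y^*\in L^2([0,\bar T];\mathbb R^m)$, $\|y^{\nu_k}-y^*\|_{L^2([0,\bar T])}\to0$ as $k\to\infty$, and $(x^*,y^*)$ is a weak solution of the original problem over $[0,\bar T]$. -/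

import Mathlib

open MeasureTheory ProbabilityTheory Filter Topology Set
open scoped Matrix

/-- Euclidean space `ℝⁿ` with the Euclidean norm. -/
abbrev Vec (n : ℕ) : Type := EuclideanSpace ℝ (Fin n)

/-- The given mappings of the dynamic system coupled with a stochastic convex program; `Ξ` is the
set in which the random vector takes its values. -/
structure CoupledData {d : ℕ} (Ξ : Set (Vec d)) (n m q : ℕ) where
  /-- right-hand side of the differential equation -/
  f : ℝ → Vec n → Vec m → Ξ → Vec n
  /-- objective function -/
  g : ℝ → Vec n → Vec m → Ξ → ℝ
  /-- constraint matrix in front of the state -/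
  A : Ξ → Matrix (Fin q) (Fin n) ℝ
  /-- constraint matrix in front of the decision variable -/
  B : Ξ → Matrix (Fin q) (Fin m) ℝ
  /-- constraint vector -/
  Q : ℝ → Ξ → Vec q
  /-- initial state -/
  x₀ : Vec n

namespace CoupledData

variable {d : ℕ} {Ξ : Set (Vec d)} {n m q : ℕ}

/-! ### Expected values; `μ` is the law of the random vector `ξ` on `Ξ` -/

/-- `E[f(t, x, y, ξ)]`. -/
noncomputable def meanF (D : CoupledData Ξ n m q) (μ : Measure Ξ)
    (t : ℝ) (x : Vec n) (y : Vec m) : Vec n :=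
  ∫ z, D.f t x y z ∂μ

/-- `E[g(t, x, y, ξ)]`. -/
noncomputable def meanG (D : CoupledData Ξ n m q) (μ : Measure Ξ)
    (t : ℝ) (x : Vec n) (y : Vec m) : ℝ :=
  ∫ z, D.g t x y z ∂μ

/-- `E[A(ξ)]`, entry by entry. -/
noncomputable def meanA (D : CoupledData Ξ n m q) (μ : Measure Ξ) : Matrix (Fin q) (Fin n) ℝ :=
  Matrix.of fun i j => ∫ z, D.A z i j ∂μ

/-- `E[B(ξ)]`, entry by entry. -/
noncomputable def meanB (D : CoupledData Ξ n m q) (μ : Measure Ξ) : Matrix (Fin q) (Fin m) ℝ :=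
  Matrix.of fun i j => ∫ z, D.B z i j ∂μ

/-- `E[Q(t, ξ)]`. -/
noncomputable def meanQ (D : CoupledData Ξ n m q) (μ : Measure Ξ) (t : ℝ) : Vec q :=
  ∫ z, D.Q t z ∂μ

/-- `K(t, x) = {y : E[A(ξ)] x + E[B(ξ)] y + E[Q(t, ξ)] ≤ 0}`. -/
def K (D : CoupledData Ξ n m q) (μ : Measure Ξ) (t : ℝ) (x : Vec n) : Set (Vec m) :=
  {y | ∀ i, (D.meanA μ *ᵥ x.ofLp) i + (D.meanB μ *ᵥ y.ofLp) i + D.meanQ μ t i ≤ 0}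

/-! ### Sample averages over the first `ν` members of a sample `s` -/

/-- `(1/ν) ∑ f(t, x, y, ξ_ℓ)`. -/
noncomputable def saaF (D : CoupledData Ξ n m q) (s : ℕ → Ξ) (ν : ℕ)
    (t : ℝ) (x : Vec n) (y : Vec m) : Vec n :=
  (1 / (ν : ℝ)) • ∑ l ∈ Finset.range ν, D.f t x y (s l)

/-- `(1/ν) ∑ g(t, x, y, ξ_ℓ)`. -/
noncomputable def saaG (D : CoupledData Ξ n m q) (s : ℕ → Ξ) (ν : ℕ)
    (t : ℝ) (x : Vec n) (y : Vec m) : ℝ :=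
  (1 / (ν : ℝ)) * ∑ l ∈ Finset.range ν, D.g t x y (s l)

/-- `K^ν(t, x) = {y : (1/ν) ∑ (A(ξ_ℓ) x + B(ξ_ℓ) y + Q(t, ξ_ℓ)) ≤ 0}`. -/
def saaK (D : CoupledData Ξ n m q) (s : ℕ → Ξ) (ν : ℕ) (t : ℝ) (x : Vec n) : Set (Vec m) :=
  {y | ∀ i, (1 / (ν : ℝ)) * ∑ l ∈ Finset.range ν,
      ((D.A (s l) *ᵥ x.ofLp) i + (D.B (s l) *ᵥ y.ofLp) i + D.Q t (s l) i) ≤ 0}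

/-! ### Solutions -/

/-- `S(t, x)`: the minimizers of `E[g(t, x, ·, ξ)]` over `K(t, x)`. -/
def S (D : CoupledData Ξ n m q) (μ : Measure Ξ) (t : ℝ) (x : Vec n) : Set (Vec m) :=
  {y | y ∈ D.K μ t x ∧ ∀ y' ∈ D.K μ t x, D.meanG μ t x y ≤ D.meanG μ t x y'}

/-- The minimizers of `(1/ν) ∑ g(t, x, ·, ξ_ℓ)` over `K^ν(t, x)`. -/
def saaS (D : CoupledData Ξ n m q) (s : ℕ → Ξ) (ν : ℕ) (t : ℝ) (x : Vec n) : Set (Vec m) :=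
  {y | y ∈ D.saaK s ν t x ∧ ∀ y' ∈ D.saaK s ν t x, D.saaG s ν t x y ≤ D.saaG s ν t x y'}

/-- `(x, y)` is a weak solution of the original problem over `[0, T]`. -/
structure IsWeakSolution (D : CoupledData Ξ n m q) (μ : Measure Ξ) (T : ℝ)
    (x : ℝ → Vec n) (y : ℝ → Vec m) : Prop where
  absolutelyContinuous : AbsolutelyContinuousOnInterval x 0 T
  integrable : IntegrableOn y (Icc 0 T)
  optimal : ∀ t ∈ Icc 0 T, y t ∈ D.S μ t (x t)
  integrable_rhs : IntegrableOn (fun τ => D.meanF μ τ (x τ) (y τ)) (Icc 0 T)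
  integral_eq : ∀ t ∈ Icc 0 T, x t = D.x₀ + ∫ τ in (0 : ℝ)..t, D.meanF μ τ (x τ) (y τ)

/-- `(x, y) ∈ C¹([0, T]) × C⁰([0, T])` solves the sample average approximation problem built on
`s 0, …, s (ν - 1)`. -/
structure IsSAASolution (D : CoupledData Ξ n m q) (s : ℕ → Ξ) (ν : ℕ) (T : ℝ)
    (x : ℝ → Vec n) (y : ℝ → Vec m) : Prop where
  contDiffOn : ContDiffOn ℝ 1 x (Icc 0 T)
  continuousOn : ContinuousOn y (Icc 0 T)
  initial : x 0 = D.x₀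
  deriv_eq : ∀ t ∈ Icc 0 T, HasDerivWithinAt x (D.saaF s ν t (x t) (y t)) (Icc 0 T) t
  optimal : ∀ t ∈ Icc 0 T, y t ∈ D.saaS s ν t (x t)

/-! ### Assumptions -/

/-- The standing assumptions on the given mappings. -/
structure StandingAssumptions (D : CoupledData Ξ n m q) (μ : Measure Ξ) : Prop where
  integrable_f : ∀ t x y, 0 ≤ t → Integrable (D.f t x y) μ
  integrable_g : ∀ t x y, 0 ≤ t → Integrable (D.g t x y) μ
  integrable_A : ∀ i j, Integrable (fun z => D.A z i j) μ
  integrable_B : ∀ i j, Integrable (fun z => D.B z i j) μ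
  integrable_Q : ∀ t, 0 ≤ t → Integrable (D.Q t) μ
  lipschitz_f : ∃ κ : Ξ → ℝ, (∀ z, 0 ≤ κ z) ∧ Integrable κ μ ∧
    ∀ᵐ z ∂μ, ∀ (t₁ t₂ : ℝ) (u₁ u₂ : Vec n) (v₁ v₂ : Vec m), 0 ≤ t₁ → 0 ≤ t₂ →
      ‖D.f t₁ u₁ v₁ z - D.f t₂ u₂ v₂ z‖ ≤ κ z * (|t₁ - t₂| + ‖u₁ - u₂‖ + ‖v₁ - v₂‖)
  convex_g : ∀ t x, 0 ≤ t → ∀ᵐ z ∂μ, ConvexOn ℝ univ (fun y => D.g t x y z)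
  continuous_g : ∀ᵐ z ∂μ, Continuous (fun p : ℝ × Vec n × Vec m => D.g p.1 p.2.1 p.2.2 z)
  continuous_Q : ∀ᵐ z ∂μ, Continuous (fun t => D.Q t z)
  bound_Q : ∃ κ : Ξ → ℝ, (∀ z, 0 ≤ κ z) ∧ Integrable κ μ ∧
    ∀ᵐ z ∂μ, ∀ t, 0 ≤ t → ‖D.Q t z‖ ≤ κ z * t
  /-- domination of `g` by an integrable function, on bounded sets of `(t, x, y)` -/
  dominated_g : ∀ R : ℝ, ∃ κ : Ξ → ℝ, Integrable κ μ ∧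
    ∀ᵐ z ∂μ, ∀ (t : ℝ) (x : Vec n) (y : Vec m), 0 ≤ t → t ≤ R → ‖x‖ ≤ R → ‖y‖ ≤ R →
      |D.g t x y z| ≤ κ z

/-- Strong convexity of the objective function with a random, integrable, positive modulus. -/
def StronglyConvexObjective (D : CoupledData Ξ n m q) (μ : Measure Ξ) : Prop :=
  ∃ ϱ : Ξ → ℝ, (∀ z, 0 < ϱ z) ∧ Integrable ϱ μ ∧
    ∀ t x, 0 ≤ t → ∀ᵐ z ∂μ, ∀ (y₁ y₂ : Vec m) (τ : ℝ), 0 < τ → τ < 1 →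
      D.g t x ((1 - τ) • y₁ + τ • y₂) z ≤
        (1 - τ) * D.g t x y₁ z + τ * D.g t x y₂ z
          - 1 / 2 * ϱ z * τ * (1 - τ) * ‖y₁ - y₂‖ ^ 2

/-- Nondegeneracy of the constraints at `(0, x₀)`: a constraint that does not involve the decision
variable in expectation and is active at `(0, x₀)` does not involve it at all. It holds whenever
some `y` satisfies all the constraints at `(0, x₀)` strictly. -/
def NondegenerateConstraints (D : CoupledData Ξ n m q) (μ : Measure Ξ) : Prop :=
  ∀ i, (∀ j, D.meanB μ i j = 0) → (D.meanA μ *ᵥ D.x₀.ofLp) i + D.meanQ μ 0 i = 0 →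
    ∀ᵐ z ∂μ, ∀ j, D.B z i j = 0

end CoupledData

/-!
For almost every realization of the sample, the averaged data converge to the expected data
uniformly on bounded sets of `(t, x, y)` with `t ≥ 0`: the integrands are continuous and dominated,
so the strong law of large numbers applies to them as random elements of the Banach space of
continuous functions on a compact set (`ae_tendstoUniformlyOn_average`). Moreover the averaged
objectives are eventually strongly convex with half the expected modulus. Everything else is a
deterministic stability theorem for such sequences of problems.

An interior point `y₀` of `K(0, x₀)` satisfies strictly every constraint that involves the
decision variable. The constraints that do not involve it hold wherever a solution exists, and so
never restrict the competitors of a minimizer. Hence `y₀` is a competitor for all approximating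
problems near `(0, x₀)`, and strong convexity bounds `y^ν(t)` as long as `x^ν(t)` is near `x₀`.
The velocity is then bounded as well, and `x^ν` cannot leave the neighbourhood before a time that
depends only on the expected data (`CoupledProblem.IsRegular.exists_apriori_bound`).

Up to that time the states are equi-Lipschitz, so a subsequence converges uniformly to some `x^*`.
At each `t`, every cluster point of `y^ν(t)` along it minimizes the expected objective over
`K(t, x^*(t))`: a feasible competitor is approached from `y₀` along strictly feasible points, which
are eventually feasible for the approximations. The minimizer is unique by strong convexity, so
`y^ν(t)` converges pointwise (`CoupledProblem.Approximates.tendsto_argmin`). In particular the limit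
is measurable, and dominated convergence yields both the `L²` convergence and the integral equation.
-/

/-! ### A uniform strong law of large numbers on compact sets -/

/-- Evaluations detect measurability of a `C(K, E)`-valued map: evaluation on a countable dense
subset of `K` is an injective continuous map between Polish spaces, hence a measurable embedding
by the Lusin–Souslin theorem. -/
theorem ContinuousMap.aemeasurable_of_eval {K E Z : Type*} [TopologicalSpace K] [CompactSpace K]
    [TopologicalSpace.MetrizableSpace K] [NormedAddCommGroup E] [CompleteSpace E]
    [SecondCountableTopology E] [MeasurableSpace Z] {μ : Measure Z} [MeasurableSpace C(K, E)]
    [BorelSpace C(K, E)] [MeasurableSpace E] [BorelSpace E]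
    {Φ : Z → C(K, E)} (hΦ : ∀ k, AEMeasurable (fun z => Φ z k) μ) : AEMeasurable Φ μ := by
  let := TopologicalSpace.metrizableSpaceMetric K
  obtain ⟨D, hDc, hD⟩ := TopologicalSpace.exists_countable_dense K
  have := hDc.to_subtype
  have hcont : Continuous (fun (φ : C(K, E)) (k : D) => φ k) :=
    continuous_pi fun k => continuous_eval_const _
  have hinj : Function.Injective (fun (φ : C(K, E)) (k : D) => φ k) := by
    intro φ ψ h
    refine DFunLike.coe_injective (φ.continuous.ext_on hD ψ.continuous fun k hk => ?_)
    exact congr_fun h ⟨k, hk⟩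
  have he := hcont.measurableEmbedding hinj
  rw [← he.aemeasurable_comp_iff]
  exact aemeasurable_pi_lambda _ fun k => hΦ k

/-- **Uniform strong law of large numbers.** If `h x z` is continuous in `x` on a compact set `K`
and dominated there by an integrable function of `z`, then the sample averages of `h` converge to
the mean almost surely, uniformly on `K`. This is the strong law for the `C(K, E)`-valued random
variables `z ↦ h · z`. -/
theorem ae_tendstoUniformlyOn_average {Ω Z X E : Type*} [MeasurableSpace Ω] {P : Measure Ω}
    [MeasurableSpace Z] {μ : Measure Z} [TopologicalSpace X] [TopologicalSpace.MetrizableSpace X]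
    [NormedAddCommGroup E] [NormedSpace ℝ E] [CompleteSpace E] [SecondCountableTopology E]
    {sample : ℕ → Ω → Z} (hmeas : ∀ l, Measurable (sample l))
    (hindep : Pairwise fun k l => IndepFun (sample k) (sample l) P)
    (hlaw : ∀ l, P.map (sample l) = μ)
    {K : Set X} (hK : IsCompact K) {h : X → Z → E}
    (hm : ∀ x ∈ K, AEStronglyMeasurable (h x) μ)
    (hc : ∀ᵐ z ∂μ, ContinuousOn (fun x => h x z) K)
    {κ : Z → ℝ} (hκ : Integrable κ μ) (hb : ∀ᵐ z ∂μ, ∀ x ∈ K, ‖h x z‖ ≤ κ z) :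
    ContinuousOn (fun x => ∫ z, h x z ∂μ) K ∧
    ∀ᵐ ω ∂P, TendstoUniformlyOn
      (fun (ν : ℕ) x => (1 / (ν : ℝ)) • ∑ l ∈ Finset.range ν, h x (sample l ω))
      (fun x => ∫ z, h x z ∂μ) atTop K := by
  have : CompactSpace K := isCompact_iff_compactSpace.1 hK
  borelize E
  borelize C(K, E)
  -- `mkD` returns its default value `0` on the null set where `h · z` is not continuous
  let Φ : Z → C(K, E) := fun z => ContinuousMap.mkD (K.domRestrict (fun x => h x z)) 0
  have hΦ : ∀ᵐ z ∂μ, ∀ x : K, Φ z x = h x z := by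
    filter_upwards [hc] with z hz x
    rw [continuousOn_iff_continuous_domRestrict] at hz
    simp only [Φ, ContinuousMap.mkD_apply_of_continuous hz, Set.domRestrict_apply]
  have hΦm : AEMeasurable Φ μ := ContinuousMap.aemeasurable_of_eval fun k =>
    (hm k k.2).aemeasurable.congr (hΦ.mono fun z hz => (hz k).symm)
  have hΦi : Integrable Φ μ := ⟨hΦm.aestronglyMeasurable,
    ContinuousMap.hasFiniteIntegral_mkD_restrict_of_bound (fun z x => h x z) 0 hc κ hκ.2 hb⟩
  have hint : ∀ x : K, (∫ z, Φ z ∂μ) x = ∫ z, h x z ∂μ := fun x => by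
    rw [ContinuousMap.integral_apply hΦi]
    exact integral_congr_ae (hΦ.mono fun z hz => hz x)
  refine ⟨?_, ?_⟩
  · rw [continuousOn_iff_continuous_domRestrict]
    exact (∫ z, Φ z ∂μ).continuous.congr fun x => hint x
  have hmap : ∀ l, AEMeasurable Φ (P.map (sample l)) := fun l => by rwa [hlaw]
  have hae : ∀ᵐ ω ∂P, ∀ l, ∀ x : K, Φ (sample l ω) x = h x (sample l ω) := by
    rw [ae_all_iff]
    intro l
    exact ae_of_ae_map (hmeas l).aemeasurable (by rwa [hlaw])
  have hslln := strong_law_ae (μ := P) (fun l ω => Φ (sample l ω))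
    (by
      have : Integrable Φ (P.map (sample 0)) := by rwa [hlaw]
      exact this.comp_measurable (hmeas 0))
    (fun k l hkl => (hindep hkl).comp₀ (hmeas k).aemeasurable (hmeas l).aemeasurable
      (hmap k) (hmap l))
    (fun l => (⟨(hmeas l).aemeasurable, (hmeas 0).aemeasurable, by rw [hlaw, hlaw]⟩ :
      IdentDistrib (sample l) (sample 0) P P).comp_of_aemeasurable (hmap l))
  have hmean : ∫ ω, Φ (sample 0 ω) ∂P = ∫ z, Φ z ∂μ := by
    rw [← hlaw 0, integral_map (hmeas 0).aemeasurable (hmap 0).aestronglyMeasurable]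
  rw [hmean] at hslln
  filter_upwards [hae, hslln] with ω hω hlim
  rw [ContinuousMap.tendsto_iff_tendstoUniformly] at hlim
  rw [tendstoUniformlyOn_iff_tendstoUniformly_comp_coe]
  intro u hu
  filter_upwards [hlim u hu] with ν hν x
  simpa [hint, hω] using hν x

/-! ### Bounds and compactness -/

/-- Sublevel sets of a strongly convex function are bounded, with a bound that depends only on the
modulus and on the size of the function on the unit ball around `y₀`. -/
theorem StrongConvexOn.norm_sub_le_of_le {Y : Type*} [NormedAddCommGroup Y] [NormedSpace ℝ Y]
    {φ : Y → ℝ} {ρ c : ℝ} (hφ : StrongConvexOn univ ρ φ) (hρ : 0 < ρ) {y₀ y : Y}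
    (hc : ∀ z ∈ Metric.closedBall y₀ 1, |φ z| ≤ c) (hy : φ y ≤ φ y₀) :
    ‖y - y₀‖ ≤ 1 + 4 * c / ρ := by
  have h0 := abs_le.1 (hc y₀ (Metric.mem_closedBall_self zero_le_one))
  have hc0 : 0 ≤ c := by linarith
  by_cases hr : ‖y - y₀‖ ≤ 1
  · exact hr.trans (le_add_of_nonneg_right (by positivity))
  push Not at hr
  set r := ‖y - y₀‖ with hr_def
  have hr0 : 0 < r := by linarith
  have hτ1 : r⁻¹ ≤ 1 := inv_le_one_of_one_le₀ hr.le
  -- compare the values at `y₀`, at `y`, and at the point of the segment at distance `1` from `y₀`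
  have hp := hφ.2 (mem_univ y) (mem_univ y₀) (inv_nonneg.2 hr0.le) (sub_nonneg.2 hτ1)
    (add_sub_cancel _ _)
  have hmem : r⁻¹ • y + (1 - r⁻¹) • y₀ ∈ Metric.closedBall y₀ 1 := by
    rw [mem_closedBall_iff_norm]
    have : r⁻¹ • y + (1 - r⁻¹) • y₀ - y₀ = r⁻¹ • (y - y₀) := by module
    rw [this, norm_smul, Real.norm_of_nonneg (by positivity), ← hr_def, inv_mul_cancel₀ hr0.ne']
  have h1 := (abs_le.1 (hc _ hmem)).1
  simp only [smul_eq_mul, ← hr_def] at hp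
  have h2 : r⁻¹ * φ y ≤ r⁻¹ * φ y₀ := by gcongr
  have h3 : r⁻¹ * (1 - r⁻¹) * (ρ / 2 * r ^ 2) = ρ / 2 * (r - 1) := by field_simp
  have h4 : ρ * (r - 1) ≤ 4 * c := by nlinarith
  have h5 : r - 1 ≤ 4 * c / ρ := by rw [le_div_iff₀ hρ]; linarith
  linarith

/-- Arzelà–Ascoli for functions on a compact subset of the line with a common Lipschitz constant. -/
theorem exists_subseq_tendstoUniformlyOn_of_lipschitz {E : Type*} [NormedAddCommGroup E]
    [ProperSpace E] {u : ℕ → ℝ → E} {s : Set ℝ} (hs : IsCompact s) {M : NNReal} {R : ℝ}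
    (hu : ∀ᶠ k in atTop, LipschitzOnWith M (u k) s ∧ ∀ t ∈ s, ‖u k t‖ ≤ R) :
    ∃ (φ : ℕ → ℕ) (v : ℝ → E), StrictMono φ ∧
      TendstoUniformlyOn (fun k => u (φ k)) v atTop s := by
  obtain ⟨N, hN⟩ := eventually_atTop.1 hu
  have : CompactSpace s := isCompact_iff_compactSpace.1 hs
  have hL : ∀ k, LipschitzWith M (s.domRestrict (u (k + N))) := fun k =>
    lipschitzOnWith_iff_restrict.1 (hN _ (Nat.le_add_left _ _)).1
  let f : ℕ → BoundedContinuousFunction s E := fun k =>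
    BoundedContinuousFunction.mkOfCompact ⟨s.domRestrict (u (k + N)), (hL k).continuous⟩
  have hcomp : IsCompact (closure (range f)) := by
    refine BoundedContinuousFunction.arzela_ascoli (Metric.closedBall 0 R)
      (isCompact_closedBall _ _) _ ?_ ?_
    · rintro _ x ⟨k, rfl⟩
      simpa [f] using (hN _ (Nat.le_add_left _ _)).2 x x.2
    · refine (LipschitzWith.uniformEquicontinuous _ M ?_).equicontinuous
      rintro ⟨_, k, rfl⟩
      exact hL k
  obtain ⟨v, -, φ, hφ, hv⟩ := hcomp.tendsto_subseq (x := f) fun k => subset_closure ⟨k, rfl⟩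
  classical
  refine ⟨fun k => φ k + N, fun t => if ht : t ∈ s then v ⟨t, ht⟩ else 0,
    fun a b hab => by simpa using hφ hab, ?_⟩
  rw [BoundedContinuousFunction.tendsto_iff_tendstoUniformly] at hv
  intro U hU
  filter_upwards [hv U hU] with k hk t ht
  simpa [ht, f] using hk ⟨t, ht⟩

theorem tendsto_eLpNorm_two_of_bounded {α Y : Type*} [MeasurableSpace α] {μ : Measure α}
    [IsFiniteMeasure μ] [NormedAddCommGroup Y] {u : ℕ → α → Y} {v : α → Y} {R : ℝ}
    (hu : ∀ k, AEStronglyMeasurable (u k) μ) (hv : AEStronglyMeasurable v μ)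
    (hb : ∀ k, ∀ᵐ a ∂μ, ‖u k a - v a‖ ≤ R)
    (hlim : ∀ᵐ a ∂μ, Tendsto (fun k => u k a) atTop (𝓝 (v a))) :
    Tendsto (fun k => eLpNorm (u k - v) 2 μ) atTop (𝓝 0) := by
  simp_rw [eLpNorm_eq_lintegral_rpow_enorm_toReal two_ne_zero ENNReal.ofNat_ne_top]
  have h : Tendsto (fun k => ∫⁻ a, ‖(u k - v) a‖ₑ ^ (2 : ENNReal).toReal ∂μ) atTop
      (𝓝 (∫⁻ _, 0 ∂μ)) := by
    refine tendsto_lintegral_of_dominated_convergence'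
      (fun _ => ENNReal.ofReal R ^ (2 : ENNReal).toReal) (fun k => ?_) (fun k => ?_) ?_ ?_
    · exact ((hu k).sub hv).enorm.pow_const _
    · filter_upwards [hb k] with a ha
      gcongr
      rw [← ofReal_norm]
      exact ENNReal.ofReal_le_ofReal ha
    · simp [lintegral_const, ENNReal.mul_eq_top]
    · filter_upwards [hlim] with a ha
      have h1 : Tendsto (fun k => ‖(u k - v) a‖ₑ) atTop (𝓝 0) := by
        have := (ha.sub_const (v a)).enorm
        simpa using this
      simpa using h1.ennrpow_const (2 : ENNReal).toReal
  simpa using h.ennrpow_const (1 / (2 : ENNReal).toReal)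

/-! ### Differential equations coupled with a convex program -/

/-- The compact set of all `(t, x, y)` with `0 ≤ t ≤ R`, `‖x‖ ≤ R` and `‖y‖ ≤ R`. -/
def timeBox (E Y : Type*) [NormedAddCommGroup E] [NormedAddCommGroup Y] (R : ℝ) :
    Set (ℝ × E × Y) :=
  Icc 0 R ×ˢ Metric.closedBall 0 R ×ˢ Metric.closedBall 0 R

/-- The data of a differential equation `x' = F (t, x, y)` in which `y` minimizes `G (t, x, ·)`
subject to the constraints `C i (t, x, ·) ≤ 0`. Both the expected value problem and its sample
average approximations have this form. -/
structure CoupledProblem (E Y ι : Type*) where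
  /-- right-hand side of the differential equation -/
  F : ℝ × E × Y → E
  /-- objective function -/
  G : ℝ × E × Y → ℝ
  /-- constraint functions, required to be nonpositive -/
  C : ι → ℝ × E × Y → ℝ

section Box

variable {E Y : Type*} [NormedAddCommGroup E] [NormedAddCommGroup Y]

theorem mem_timeBox {R t : ℝ} {x : E} {y : Y} :
    (t, x, y) ∈ timeBox E Y R ↔ (0 ≤ t ∧ t ≤ R) ∧ ‖x‖ ≤ R ∧ ‖y‖ ≤ R := by
  simp [timeBox]

theorem isCompact_timeBox [ProperSpace E] [ProperSpace Y] (R : ℝ) : IsCompact (timeBox E Y R) :=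
  isCompact_Icc.prod ((isCompact_closedBall _ _).prod (isCompact_closedBall _ _))

/-- Uniform convergence on all boxes to a continuous limit gives convergence along convergent
states and decisions. The time is fixed, since a box contains no neighbourhood of its points at
time `0`. -/
theorem tendsto_of_tendstoUniformlyOn_timeBox {Z : Type*} [UniformSpace Z] {κ : Type*}
    {l : Filter κ} {h : κ → ℝ × E × Y → Z} {h₀ : ℝ × E × Y → Z}
    (hlim : ∀ R, TendstoUniformlyOn h h₀ l (timeBox E Y R))
    (hcont : ∀ R, ContinuousOn h₀ (timeBox E Y R)) {t : ℝ} (ht : 0 ≤ t)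
    {x : κ → E} {x₀ : E} (hx : Tendsto x l (𝓝 x₀)) {y : κ → Y} {y₀ : Y}
    (hy : Tendsto y l (𝓝 y₀)) :
    Tendsto (fun k => h k (t, x k, y k)) l (𝓝 (h₀ (t, x₀, y₀))) := by
  set R := t + ‖x₀‖ + ‖y₀‖ + 1 with hR
  have n1 := norm_nonneg x₀
  have n2 := norm_nonneg y₀
  have hmem : (t, x₀, y₀) ∈ timeBox E Y R :=
    mem_timeBox.2 ⟨⟨ht, by linarith⟩, by linarith, by linarith⟩
  refine (hlim R).tendsto_comp (g := fun k => (t, x k, y k)) (hcont R _ hmem) ?_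
  · refine tendsto_nhdsWithin_iff.2 ⟨tendsto_const_nhds.prodMk_nhds (hx.prodMk_nhds hy), ?_⟩
    filter_upwards [hx.norm.eventually_lt_const (show ‖x₀‖ < R by linarith),
      hy.norm.eventually_lt_const (show ‖y₀‖ < R by linarith)] with k h1 h2
    exact mem_timeBox.2 ⟨⟨ht, by linarith⟩, h1.le, h2.le⟩

/-- The bound `M` depends only on the limit `h₀`, not on the sequence that converges to it. -/
theorem eventually_norm_le_of_tendstoUniformlyOn_timeBox [ProperSpace E] [ProperSpace Y]
    {Z : Type*} [NormedAddCommGroup Z] {h₀ : ℝ × E × Y → Z} {R : ℝ}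
    (hcont : ContinuousOn h₀ (timeBox E Y R)) :
    ∃ M, 0 < M ∧ ∀ h : ℕ → ℝ × E × Y → Z, TendstoUniformlyOn h h₀ atTop (timeBox E Y R) →
      ∀ᶠ k in atTop, ∀ p ∈ timeBox E Y R, ‖h k p‖ ≤ M := by
  obtain ⟨M₀, hM₀⟩ := (isCompact_timeBox R).exists_bound_of_continuousOn hcont
  refine ⟨|M₀| + 1, by positivity, fun h hlim => ?_⟩
  filter_upwards [Metric.tendstoUniformlyOn_iff.1 hlim 1 one_pos] with k hk p hp
  have h1 := hk p hp
  rw [dist_eq_norm] at h1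
  have h2 := norm_sub_norm_le (h k p) (h₀ p)
  rw [norm_sub_rev] at h2
  linarith [hM₀ p hp, le_abs_self M₀]

end Box

namespace CoupledProblem

variable {E Y ι : Type*}

/-- The points that satisfy all the constraints at `(t, x)`. -/
def feasible (p : CoupledProblem E Y ι) (t : ℝ) (x : E) : Set Y :=
  {y | ∀ i, p.C i (t, x, y) ≤ 0}

/-- The minimizers of `G (t, x, ·)` over the feasible set at `(t, x)`. -/
def argmin (p : CoupledProblem E Y ι) (t : ℝ) (x : E) : Set Y :=
  {y | y ∈ p.feasible t x ∧ ∀ y' ∈ p.feasible t x, p.G (t, x, y) ≤ p.G (t, x, y')}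

/-- As soon as some `y` is feasible at `(t, x)`, the constraints that do not involve the decision
variable hold at `(t, x)`, so only the others have to be checked for `y'`. -/
theorem feasible_of_slater {p : CoupledProblem E Y ι} {I : Set ι}
    (hI : ∀ i ∈ I, ∀ t x y y', p.C i (t, x, y) = p.C i (t, x, y')) {t : ℝ} {x : E} {y y' : Y}
    (hy : y ∈ p.feasible t x) (hy' : ∀ i ∉ I, p.C i (t, x, y') < 0) : y' ∈ p.feasible t x := by
  intro i
  by_cases hi : i ∈ I
  · rw [hI i hi t x y' y]
    exact hy i
  · exact (hy' i hi).le

variable [NormedAddCommGroup E] [NormedAddCommGroup Y]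

/-- `(x, y)` is a solution on `[0, T]` with `x` continuously differentiable and `y` continuous. -/
structure IsClassicalSolution [NormedSpace ℝ E] (p : CoupledProblem E Y ι) (x₀ : E) (T : ℝ)
    (x : ℝ → E) (y : ℝ → Y) : Prop where
  continuousOn : ContinuousOn y (Icc 0 T)
  initial : x 0 = x₀
  hasDerivWithinAt : ∀ t ∈ Icc 0 T, HasDerivWithinAt x (p.F (t, x t, y t)) (Icc 0 T) t
  continuousOn_rhs : ContinuousOn (fun t => p.F (t, x t, y t)) (Icc 0 T)
  optimal : ∀ t ∈ Icc 0 T, y t ∈ p.argmin t (x t)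

/-- The properties required of the limit problem. The constraints outside `I` are strict at
`(0, x₀, y₀)`; nothing is asked there of the constraints in `I`, which are meant to be those that do
not involve the decision variable. -/
structure IsRegular [NormedSpace ℝ Y] (q : CoupledProblem E Y ι) (x₀ : E) (y₀ : Y)
    (I : Set ι) : Prop where
  continuousOn_F : ∀ R, ContinuousOn q.F (timeBox E Y R)
  continuousOn_G : ∀ R, ContinuousOn q.G (timeBox E Y R)
  continuousOn_C : ∀ i R, ContinuousOn (q.C i) (timeBox E Y R)
  convexOn_C : ∀ i t x, 0 ≤ t → ConvexOn ℝ univ fun y => q.C i (t, x, y)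
  slater : ∀ i ∉ I, q.C i (0, x₀, y₀) < 0

/-- The problems `p ν` converge to `q` uniformly on bounded sets, and eventually their objectives
are strongly convex with a common modulus `ρ` and their constraints in `I` do not involve the
decision variable. -/
structure Approximates [NormedSpace ℝ Y] (p : ℕ → CoupledProblem E Y ι)
    (q : CoupledProblem E Y ι) (I : Set ι) (ρ : ℝ) : Prop where
  tendsto_F : ∀ R, TendstoUniformlyOn (fun ν => (p ν).F) q.F atTop (timeBox E Y R)
  tendsto_G : ∀ R, TendstoUniformlyOn (fun ν => (p ν).G) q.G atTop (timeBox E Y R)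
  tendsto_C : ∀ i R, TendstoUniformlyOn (fun ν => (p ν).C i) (q.C i) atTop (timeBox E Y R)
  strongConvexOn : ∀ᶠ ν in atTop, ∀ t x, 0 ≤ t →
    StrongConvexOn univ ρ fun y => (p ν).G (t, x, y)
  indep : ∀ᶠ ν in atTop, ∀ i ∈ I, ∀ t x y y', (p ν).C i (t, x, y) = (p ν).C i (t, x, y')

variable [NormedSpace ℝ Y]

theorem Approximates.comp {p : ℕ → CoupledProblem E Y ι} {q : CoupledProblem E Y ι} {I : Set ι}
    {ρ : ℝ} (h : Approximates p q I ρ) {φ : ℕ → ℕ} (hφ : Tendsto φ atTop atTop) :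
    Approximates (fun k => p (φ k)) q I ρ where
  tendsto_F R u hu := hφ.eventually (h.tendsto_F R u hu)
  tendsto_G R u hu := hφ.eventually (h.tendsto_G R u hu)
  tendsto_C i R u hu := hφ.eventually (h.tendsto_C i R u hu)
  strongConvexOn := hφ.eventually h.strongConvexOn
  indep := hφ.eventually h.indep

/-- The Slater point `y₀` stays strictly feasible near `(0, x₀)`, with a uniform margin. -/
theorem IsRegular.exists_uniform_slater [Finite ι] {q : CoupledProblem E Y ι} {x₀ : E} {y₀ : Y}
    {I : Set ι} (hq : q.IsRegular x₀ y₀ I) :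
    ∃ δ > 0, δ ≤ 1 ∧ ∀ t ∈ Icc 0 δ, ∀ x, ‖x - x₀‖ ≤ δ → ∀ i ∉ I,
      q.C i (t, x, y₀) < q.C i (0, x₀, y₀) / 2 := by
  set R := ‖x₀‖ + ‖y₀‖ + 1 with hR
  have n1 := norm_nonneg x₀
  have n2 := norm_nonneg y₀
  have hmem : (0, x₀, y₀) ∈ timeBox E Y R :=
    mem_timeBox.2 ⟨⟨le_rfl, by linarith⟩, by linarith, by linarith⟩
  have hev : ∀ᶠ p in 𝓝[timeBox E Y R] (0, x₀, y₀), ∀ i, i ∉ I →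
      q.C i p < q.C i (0, x₀, y₀) / 2 := by
    refine eventually_all.2 fun i => ?_
    by_cases hi : i ∈ I
    · exact Eventually.of_forall fun _ h => absurd hi h
    · filter_upwards [(hq.continuousOn_C i R _ hmem).eventually_lt_const
        (show q.C i (0, x₀, y₀) < q.C i (0, x₀, y₀) / 2 by linarith [hq.slater i hi])] with p hp _
      exact hp
  obtain ⟨ε, hε, hball⟩ := Metric.mem_nhdsWithin_iff.1 hev
  refine ⟨min (ε / 2) 1, by positivity, min_le_right _ _, fun t ht x hx i hi => ?_⟩
  have h1 := min_le_left (ε / 2) 1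
  have h2 := min_le_right (ε / 2) 1
  refine hball ⟨?_, mem_timeBox.2 ⟨⟨ht.1, ?_⟩, ?_, ?_⟩⟩ i hi
  · simp only [Metric.mem_ball, Prod.dist_eq, dist_self, Real.dist_eq, sub_zero, abs_of_nonneg ht.1,
      dist_eq_norm x, max_lt_iff]
    exact ⟨by linarith [ht.2], by linarith, hε⟩
  · linarith [ht.2]
  · linarith [norm_le_norm_add_norm_sub' x x₀]
  · linarith

/-- There is a time `Tb` up to which all solutions of late approximating problems obey common
bounds. None of the constants depends on the approximating sequence, which is what makes the final
time deterministic when the sequence is random. -/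
theorem IsRegular.exists_apriori_bound [NormedSpace ℝ E] [ProperSpace E] [ProperSpace Y] [Finite ι]
    {q : CoupledProblem E Y ι} {x₀ : E} {y₀ : Y}
    {I : Set ι} (hq : q.IsRegular x₀ y₀ I) {ρ : ℝ} (hρ : 0 < ρ) {T : ℝ} (hT : 0 < T) :
    ∃ Tb δ R M : ℝ, 0 < Tb ∧ Tb ≤ T ∧ 0 < M ∧
      (∀ t ∈ Icc 0 Tb, ∀ x, ‖x - x₀‖ ≤ δ → ∀ i ∉ I, q.C i (t, x, y₀) < 0) ∧
      ∀ p, Approximates p q I ρ → ∀ᶠ ν in atTop, ∀ x y, (p ν).IsClassicalSolution x₀ T x y →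
        ∀ t ∈ Icc 0 Tb, ‖x t - x₀‖ ≤ δ ∧ ‖x t‖ ≤ R ∧ ‖y t‖ ≤ R ∧
          ‖(p ν).F (t, x t, y t)‖ ≤ M := by
  obtain ⟨δ, hδ, hδ1, hsl⟩ := hq.exists_uniform_slater
  have n1 := norm_nonneg x₀
  have n2 := norm_nonneg y₀
  set R₀ := ‖x₀‖ + ‖y₀‖ + 1 with hR₀
  obtain ⟨c, hc, hGb⟩ := eventually_norm_le_of_tendstoUniformlyOn_timeBox (hq.continuousOn_G R₀)
  set R := R₀ + 4 * c / ρ with hR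
  have hcρ : 0 < 4 * c / ρ := by positivity
  obtain ⟨M, hM, hFb⟩ := eventually_norm_le_of_tendstoUniformlyOn_timeBox (hq.continuousOn_F R)
  set Tb := min T (δ / (M + 1)) with hTb
  have hTbδ : (M + 1) * Tb ≤ δ := by
    have : Tb ≤ δ / (M + 1) := min_le_right _ _
    rw [le_div_iff₀ (by positivity)] at this
    linarith
  have hTb0 : 0 < Tb := by positivity
  have hTbδ' : Tb ≤ δ := by nlinarith
  have hTbT : Tb ≤ T := min_le_left _ _
  refine ⟨Tb, δ, R, M, hTb0, hTbT, hM, fun t ht x hx i hi => ?_, fun p hp => ?_⟩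
  · linarith [hsl t ⟨ht.1, ht.2.trans hTbδ'⟩ x hx i hi, hq.slater i hi]
  have hCev : ∀ᶠ ν in atTop, ∀ i, i ∉ I → ∀ z ∈ timeBox E Y R₀,
      (p ν).C i z < q.C i z - q.C i (0, x₀, y₀) / 2 := by
    refine eventually_all.2 fun i => ?_
    by_cases hi : i ∈ I
    · exact Eventually.of_forall fun _ h => absurd hi h
    · filter_upwards [Metric.tendstoUniformlyOn_iff.1 (hp.tendsto_C i R₀)
        (-(q.C i (0, x₀, y₀) / 2)) (by linarith [hq.slater i hi])] with ν hν _ z hz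
      have := (abs_lt.1 (hν z hz)).1
      linarith
  filter_upwards [hCev, hGb _ (hp.tendsto_G R₀), hFb _ (hp.tendsto_F R), hp.strongConvexOn,
    hp.indep] with ν hC hG hF hconv hind x y hsol
  -- as long as `x` stays within `δ` of `x₀`, the decision and the velocity are bounded
  have key : ∀ t ∈ Icc 0 Tb, ‖x t - x₀‖ ≤ δ → ‖x t‖ ≤ R ∧ ‖y t‖ ≤ R ∧
      ‖(p ν).F (t, x t, y t)‖ ≤ M := by
    intro t ht hx
    have htδ : t ∈ Icc 0 δ := ⟨ht.1, ht.2.trans hTbδ'⟩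
    have hxR : ‖x t‖ ≤ R₀ := by linarith [norm_le_norm_add_norm_sub' (x t) x₀]
    have htR : t ≤ R₀ := by linarith [htδ.2]
    have hopt := hsol.optimal t ⟨ht.1, ht.2.trans hTbT⟩
    have hy₀ : y₀ ∈ (p ν).feasible t (x t) := by
      refine feasible_of_slater hind hopt.1 fun i hi => ?_
      have h1 := hC i hi (t, x t, y₀) (mem_timeBox.2 ⟨⟨ht.1, htR⟩, hxR, by linarith⟩)
      linarith [hsl t htδ (x t) hx i hi]
    have hyb : ‖y t - y₀‖ ≤ 1 + 4 * c / ρ := by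
      refine (hconv t (x t) ht.1).norm_sub_le_of_le hρ (fun z hz => ?_) (hopt.2 y₀ hy₀)
      refine hG _ (mem_timeBox.2 ⟨⟨ht.1, htR⟩, hxR, ?_⟩)
      rw [mem_closedBall_iff_norm] at hz
      linarith [norm_le_norm_add_norm_sub' z y₀]
    have hyR : ‖y t‖ ≤ R := by linarith [norm_le_norm_add_norm_sub' (y t) y₀]
    exact ⟨by linarith, hyR, hF _ (mem_timeBox.2 ⟨⟨ht.1, by linarith⟩, by linarith, hyR⟩)⟩
  -- the velocity is at most `M < M + 1`, so `x` cannot leave the cone `‖x t - x₀‖ ≤ (M + 1) * t`,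
  -- which up to time `Tb` lies within `δ` of `x₀`
  have hfence : ∀ ⦃t⦄, t ∈ Icc 0 Tb → ‖x t - x₀‖ ≤ (M + 1) * t := by
    refine image_norm_le_of_norm_deriv_right_lt_deriv_boundary
      (f' := fun t => (p ν).F (t, x t, y t)) (B' := fun _ => M + 1) (fun t ht => ?_)
      (fun t ht => ?_) (by simp [hsol.initial])
      (fun t => by simpa using (hasDerivAt_id t).const_mul (M + 1)) (fun t ht heq => ?_)
    · exact (((hsol.hasDerivWithinAt t ⟨ht.1, ht.2.trans hTbT⟩).continuousWithinAt).mono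
        (Icc_subset_Icc_right hTbT)).sub continuousWithinAt_const
    · have hderiv := (hsol.hasDerivWithinAt t ⟨ht.1, ht.2.le.trans hTbT⟩).sub_const x₀
      refine hderiv.mono_of_mem_nhdsWithin ?_
      exact Icc_mem_nhdsGE_of_mem ⟨ht.1, ht.2.trans_le hTbT⟩
    · have : ‖x t - x₀‖ ≤ δ := by
        rw [heq]
        exact (mul_le_mul_of_nonneg_left ht.2.le (by positivity)).trans hTbδ
      linarith [(key t ⟨ht.1, ht.2.le⟩ this).2.2]
  intro t ht
  have hx : ‖x t - x₀‖ ≤ δ :=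
    (hfence ht).trans ((mul_le_mul_of_nonneg_left ht.2 (by positivity)).trans hTbδ)
  exact ⟨hx, key t ht hx⟩

theorem Approximates.strongConvexOn_limit {p : ℕ → CoupledProblem E Y ι}
    {q : CoupledProblem E Y ι} {x₀ : E} {y₀ : Y} {I : Set ι} {ρ : ℝ} (hp : Approximates p q I ρ)
    (hq : q.IsRegular x₀ y₀ I) {t : ℝ} (ht : 0 ≤ t) (x : E) :
    StrongConvexOn univ ρ fun y => q.G (t, x, y) := by
  have hlim : ∀ y, Tendsto (fun ν => (p ν).G (t, x, y)) atTop (𝓝 (q.G (t, x, y))) := fun y =>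
    tendsto_of_tendstoUniformlyOn_timeBox hp.tendsto_G hq.continuousOn_G ht tendsto_const_nhds
      tendsto_const_nhds
  refine ⟨convex_univ, fun y₁ _ y₂ _ a b ha hb hab => ?_⟩
  refine le_of_tendsto_of_tendsto (hlim _)
    ((((hlim y₁).const_smul a).add ((hlim y₂).const_smul b)).sub_const _) ?_
  filter_upwards [hp.strongConvexOn] with ν hν
  exact (hν t x ht).2 (mem_univ _) (mem_univ _) ha hb hab

/-- Stability of the minimizers: by compactness it suffices that every cluster point of the
minimizers is a minimizer of the limit problem, since the latter is unique by strong convexity. -/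
theorem Approximates.tendsto_argmin [ProperSpace Y] [Finite ι] {p : ℕ → CoupledProblem E Y ι}
    {q : CoupledProblem E Y ι} {x₀ : E} {y₀ : Y} {I : Set ι} {ρ : ℝ} (hp : Approximates p q I ρ)
    (hq : q.IsRegular x₀ y₀ I) (hρ : 0 < ρ) {t : ℝ} (ht : 0 ≤ t) {x : ℕ → E} {xs : E}
    (hx : Tendsto x atTop (𝓝 xs)) {y : ℕ → Y} {R : ℝ} (hyR : ∀ᶠ k in atTop, ‖y k‖ ≤ R)
    (hy : ∀ᶠ k in atTop, y k ∈ (p k).argmin t (x k)) (hsl : ∀ i ∉ I, q.C i (t, xs, y₀) < 0) :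
    ∃ ys ∈ q.argmin t xs, Tendsto y atTop (𝓝 ys) := by
  have hclus : ∀ a, MapClusterPt a atTop y → a ∈ q.argmin t xs := by
    intro a ha
    obtain ⟨ψ, hψ, hya⟩ := ha.tendsto_subseq
    have hp' := hp.comp hψ.tendsto_atTop
    have hx' := hx.comp hψ.tendsto_atTop
    have hy' := hψ.tendsto_atTop.eventually hy
    refine ⟨fun i => ?_, fun b hb => ?_⟩
    · refine le_of_tendsto (tendsto_of_tendstoUniformlyOn_timeBox (hp'.tendsto_C i)
        (hq.continuousOn_C i) ht hx' hya) ?_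
      exact hy'.mono fun k hk => hk.1 i
    -- `b` is approached from the Slater point along a segment of strictly feasible points
    have hseg : ∀ ε ∈ Ioc (0 : ℝ) 1,
        q.G (t, xs, a) ≤ (1 - ε) * q.G (t, xs, b) + ε * q.G (t, xs, y₀) := by
      intro ε hε
      have h1ε : 0 ≤ 1 - ε := sub_nonneg.2 hε.2
      set w := (1 - ε) • b + ε • y₀ with hw
      have hstrict : ∀ i, i ∉ I → q.C i (t, xs, w) < 0 := by
        intro i hi
        have h1 := (hq.convexOn_C i t xs ht).2 (mem_univ b) (mem_univ y₀) h1ε hε.1.le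
          (sub_add_cancel _ _)
        have h2 := mul_nonpos_of_nonneg_of_nonpos h1ε (hb i)
        have h3 := mul_neg_of_pos_of_neg hε.1 (hsl i hi)
        simp only [smul_eq_mul] at h1
        linarith
      have hfeas : ∀ᶠ k in atTop, ∀ i, i ∉ I → (p (ψ k)).C i (t, x (ψ k), w) < 0 := by
        refine eventually_all.2 fun i => ?_
        by_cases hi : i ∈ I
        · exact Eventually.of_forall fun _ h => absurd hi h
        · filter_upwards [(tendsto_of_tendstoUniformlyOn_timeBox (hp'.tendsto_C i)
            (hq.continuousOn_C i) ht hx' (tendsto_const_nhds (x := w))).eventually_lt_const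
            (hstrict i hi)] with k hk _
          exact hk
      have hle : q.G (t, xs, a) ≤ q.G (t, xs, w) := by
        refine le_of_tendsto_of_tendsto
          (tendsto_of_tendstoUniformlyOn_timeBox hp'.tendsto_G hq.continuousOn_G ht hx' hya)
          (tendsto_of_tendstoUniformlyOn_timeBox hp'.tendsto_G hq.continuousOn_G ht hx'
            (tendsto_const_nhds (x := w))) ?_
        filter_upwards [hfeas, hy', hp'.indep] with k h1 h2 h3
        exact h2.2 w (feasible_of_slater h3 h2.1 h1)
      exact hle.trans (((hp.strongConvexOn_limit hq ht xs).strictConvexOn hρ).convexOn.2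
        (mem_univ b) (mem_univ y₀) h1ε hε.1.le (sub_add_cancel _ _))
    have hlim : Tendsto (fun ε : ℝ => (1 - ε) * q.G (t, xs, b) + ε * q.G (t, xs, y₀)) (𝓝[>] 0)
        (𝓝 (q.G (t, xs, b))) := by
      have : Continuous fun ε : ℝ => (1 - ε) * q.G (t, xs, b) + ε * q.G (t, xs, y₀) := by
        fun_prop
      simpa using (this.tendsto 0).mono_left nhdsWithin_le_nhds
    exact ge_of_tendsto hlim (by filter_upwards [Ioc_mem_nhdsGT one_pos] with ε hε using hseg ε hε)
  have hmem : ∀ᶠ k in atTop, y k ∈ Metric.closedBall (0 : Y) R := by simpa using hyR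
  obtain ⟨ys, -, hys⟩ := (isCompact_closedBall (0 : Y) R).exists_mapClusterPt_of_frequently
    hmem.frequently
  refine ⟨ys, hclus ys hys, (isCompact_closedBall (0 : Y) R).tendsto_nhds_of_unique_mapClusterPt
    hmem fun b _ hb => ?_⟩
  have hK : Convex ℝ (q.feasible t xs) := by
    have : q.feasible t xs = ⋂ i, {y | y ∈ univ ∧ q.C i (t, xs, y) ≤ 0} := by
      ext; simp [feasible]
    rw [this]
    exact convex_iInter fun i => (hq.convexOn_C i t xs ht).convex_le 0
  have hstrict := ((hp.strongConvexOn_limit hq ht xs).strictConvexOn hρ).subset (subset_univ _) hK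
  exact hstrict.eq_of_isMinOn (hclus b hb).2 (hclus ys hys).2 (hclus b hb).1 (hclus ys hys).1

end CoupledProblem

/-! ### Passage to the limit along a subsequence -/

namespace CoupledProblem

variable {E Y ι : Type*} [NormedAddCommGroup E] [NormedSpace ℝ E]
  [NormedAddCommGroup Y]

theorem IsClassicalSolution.mono {p : CoupledProblem E Y ι} {x₀ : E} {T T' : ℝ} {x : ℝ → E}
    {y : ℝ → Y} (h : p.IsClassicalSolution x₀ T x y) (hT : T' ≤ T) :
    p.IsClassicalSolution x₀ T' x y :=
  have hsub : Icc 0 T' ⊆ Icc 0 T := Icc_subset_Icc_right hT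
  { continuousOn := h.continuousOn.mono hsub
    initial := h.initial
    hasDerivWithinAt := fun t ht => (h.hasDerivWithinAt t (hsub ht)).mono hsub
    continuousOn_rhs := h.continuousOn_rhs.mono hsub
    optimal := fun t ht => h.optimal t (hsub ht) }

theorem IsClassicalSolution.integral_eq [CompleteSpace E] {p : CoupledProblem E Y ι} {x₀ : E}
    {T : ℝ} {x : ℝ → E} {y : ℝ → Y} (h : p.IsClassicalSolution x₀ T x y) {t : ℝ}
    (ht : t ∈ Icc 0 T) : x t = x₀ + ∫ τ in (0 : ℝ)..t, p.F (τ, x τ, y τ) := by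
  have hsub : Icc 0 t ⊆ Icc 0 T := Icc_subset_Icc_right ht.2
  rw [intervalIntegral.integral_eq_sub_of_hasDerivAt_of_le ht.1 (f := x), h.initial]
  · abel
  · exact fun τ hτ => (h.hasDerivWithinAt τ (hsub hτ)).continuousWithinAt.mono hsub
  · exact fun τ hτ => (h.hasDerivWithinAt τ (hsub ⟨hτ.1.le, hτ.2.le⟩)).hasDerivAt
      (Icc_mem_nhds hτ.1 (hτ.2.trans_le ht.2))
  · exact (h.continuousOn_rhs.mono (by rwa [uIcc_of_le ht.1])).intervalIntegrable

theorem IsClassicalSolution.lipschitzOnWith {p : CoupledProblem E Y ι} {x₀ : E}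
    {T : ℝ} {x : ℝ → E} {y : ℝ → Y} (h : p.IsClassicalSolution x₀ T x y) {M : NNReal}
    (hM : ∀ t ∈ Icc 0 T, ‖p.F (t, x t, y t)‖ ≤ M) : LipschitzOnWith M x (Icc 0 T) :=
  (convex_Icc 0 T).lipschitzOnWith_of_nnnorm_hasDerivWithin_le h.hasDerivWithinAt hM

/-- Solutions of the approximating problems that obey common bounds converge along a subsequence
to a solution of the limit problem. Only the states need a subsequence; the decisions then
converge pointwise by stability of the minimizers, and dominated convergence does the rest. -/
theorem Approximates.exists_subseq_tendsto_weakSolution [NormedSpace ℝ Y] [ProperSpace E]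
    [ProperSpace Y] [Finite ι]
    {q : CoupledProblem E Y ι} {x₀ : E} {y₀ : Y} {I : Set ι} (hq : q.IsRegular x₀ y₀ I)
    {p : ℕ → CoupledProblem E Y ι} {ρ : ℝ} (hp : Approximates p q I ρ) (hρ : 0 < ρ)
    {T δ R M : ℝ} (hM : 0 < M) {x : ℕ → ℝ → E} {y : ℕ → ℝ → Y}
    (hslater : ∀ t ∈ Icc 0 T, ∀ z, ‖z - x₀‖ ≤ δ → ∀ i ∉ I, q.C i (t, z, y₀) < 0)
    (hsol : ∀ᶠ ν in atTop, (p ν).IsClassicalSolution x₀ T (x ν) (y ν))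
    (hbound : ∀ᶠ ν in atTop, ∀ t ∈ Icc 0 T, ‖x ν t - x₀‖ ≤ δ ∧ ‖x ν t‖ ≤ R ∧ ‖y ν t‖ ≤ R ∧
      ‖(p ν).F (t, x ν t, y ν t)‖ ≤ M) :
    ∃ (φ : ℕ → ℕ) (xs : ℝ → E) (ys : ℝ → Y), StrictMono φ ∧
      TendstoUniformlyOn (fun k => x (φ k)) xs atTop (Icc 0 T) ∧
      MemLp ys 2 (volume.restrict (Icc 0 T)) ∧
      Tendsto (fun k => eLpNorm (y (φ k) - ys) 2 (volume.restrict (Icc 0 T))) atTop (𝓝 0) ∧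
      LipschitzOnWith M.toNNReal xs (Icc 0 T) ∧
      (∀ t ∈ Icc 0 T, ys t ∈ q.argmin t (xs t)) ∧
      IntegrableOn (fun τ => q.F (τ, xs τ, ys τ)) (Icc 0 T) ∧
      ∀ t ∈ Icc 0 T, xs t = x₀ + ∫ τ in (0 : ℝ)..t, q.F (τ, xs τ, ys τ) := by
  have hM' : (M.toNNReal : ℝ) = M := Real.coe_toNNReal M hM.le
  obtain ⟨φ₀, xs, hφ₀, hxs₀⟩ := exists_subseq_tendstoUniformlyOn_of_lipschitz (u := x)
    (isCompact_Icc (a := (0 : ℝ)) (b := T)) (M := M.toNNReal) (R := R) (by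
      filter_upwards [hsol, hbound] with ν h1 h2
      exact ⟨h1.lipschitzOnWith fun t ht => by simpa [hM'] using (h2 t ht).2.2.2,
        fun t ht => (h2 t ht).2.1⟩)
  -- dropping finitely many indices, all members are solutions that obey the bounds
  obtain ⟨N, hN⟩ := eventually_atTop.1 (hsol.and hbound)
  set φ : ℕ → ℕ := fun k => φ₀ (k + N) with hφ_def
  have hφ : StrictMono φ := fun a b hab => hφ₀ (by simpa using hab)
  have hφN : ∀ k, N ≤ φ k := fun k => (Nat.le_add_left N k).trans hφ₀.le_apply
  have hxs : TendstoUniformlyOn (fun k => x (φ k)) xs atTop (Icc 0 T) := fun u hu =>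
    (tendsto_add_atTop_nat N).eventually (hxs₀ u hu)
  have hsolφ := fun k => (hN (φ k) (hφN k)).1
  have hbφ := fun k => (hN (φ k) (hφN k)).2
  have hpφ := hp.comp hφ.tendsto_atTop
  have hxlim : ∀ t ∈ Icc 0 T, Tendsto (fun k => x (φ k) t) atTop (𝓝 (xs t)) := fun t ht =>
    hxs.tendsto_at ht
  have hδ : ∀ t ∈ Icc 0 T, ‖xs t - x₀‖ ≤ δ := fun t ht =>
    le_of_tendsto ((hxlim t ht).sub_const x₀).norm (Eventually.of_forall fun k => (hbφ k t ht).1)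
  have hys : ∀ t : ℝ, ∃ b : Y, t ∈ Icc 0 T →
      b ∈ q.argmin t (xs t) ∧ Tendsto (fun k => y (φ k) t) atTop (𝓝 b) := by
    intro t
    by_cases ht : t ∈ Icc 0 T
    · obtain ⟨b, hb, hlim⟩ := hpφ.tendsto_argmin hq hρ ht.1 (hxlim t ht) (y := fun k => y (φ k) t)
        (Eventually.of_forall fun k => (hbφ k t ht).2.2.1)
        (Eventually.of_forall fun k => (hsolφ k).optimal t ht) (hslater t ht _ (hδ t ht))
      exact ⟨b, fun _ => ⟨hb, hlim⟩⟩
    · exact ⟨0, fun h => absurd h ht⟩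
  choose ys hys using hys
  have hFlim : ∀ t ∈ Icc 0 T, Tendsto (fun k => (p (φ k)).F (t, x (φ k) t, y (φ k) t)) atTop
      (𝓝 (q.F (t, xs t, ys t))) := fun t ht =>
    tendsto_of_tendstoUniformlyOn_timeBox hpφ.tendsto_F hq.continuousOn_F ht.1 (hxlim t ht)
      (hys t ht).2
  have hym : ∀ k, AEStronglyMeasurable (y (φ k)) (volume.restrict (Icc 0 T)) := fun k =>
    (hsolφ k).continuousOn.aestronglyMeasurable measurableSet_Icc
  have hysm : AEStronglyMeasurable ys (volume.restrict (Icc 0 T)) :=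
    aestronglyMeasurable_of_tendsto_ae atTop hym
      (ae_restrict_of_forall_mem measurableSet_Icc fun t ht => (hys t ht).2)
  have hysR : ∀ t ∈ Icc 0 T, ‖ys t‖ ≤ R := fun t ht =>
    le_of_tendsto (hys t ht).2.norm (Eventually.of_forall fun k => (hbφ k t ht).2.2.1)
  have hFm : ∀ k, AEStronglyMeasurable (fun t => (p (φ k)).F (t, x (φ k) t, y (φ k) t))
      (volume.restrict (Icc 0 T)) := fun k =>
    (hsolφ k).continuousOn_rhs.aestronglyMeasurable measurableSet_Icc
  have hqFm : AEStronglyMeasurable (fun t => q.F (t, xs t, ys t)) (volume.restrict (Icc 0 T)) :=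
    aestronglyMeasurable_of_tendsto_ae atTop hFm
      (ae_restrict_of_forall_mem measurableSet_Icc hFlim)
  have hqFM : ∀ t ∈ Icc 0 T, ‖q.F (t, xs t, ys t)‖ ≤ M := fun t ht =>
    le_of_tendsto (hFlim t ht).norm (Eventually.of_forall fun k => (hbφ k t ht).2.2.2)
  refine ⟨φ, xs, ys, hφ, hxs, ?_, ?_, ?_, fun t ht => (hys t ht).1, ?_, fun t ht => ?_⟩
  · exact MemLp.of_bound hysm R (ae_restrict_of_forall_mem measurableSet_Icc hysR)
  · refine tendsto_eLpNorm_two_of_bounded (R := R + R) hym hysm (fun k => ?_)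
      (ae_restrict_of_forall_mem measurableSet_Icc fun t ht => (hys t ht).2)
    refine ae_restrict_of_forall_mem measurableSet_Icc fun t ht => ?_
    exact (norm_sub_le _ _).trans (add_le_add (hbφ k t ht).2.2.1 (hysR t ht))
  · refine LipschitzOnWith.of_dist_le_mul fun s hs t ht => ?_
    refine le_of_tendsto ((hxlim s hs).dist (hxlim t ht)) (Eventually.of_forall fun k => ?_)
    have hlip := (hsolφ k).lipschitzOnWith (M := M.toNNReal) fun t ht => by
      simpa [hM'] using (hbφ k t ht).2.2.2
    exact hlip.dist_le_mul s hs t ht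
  · exact IntegrableOn.of_bound (by simp) hqFm M
      (ae_restrict_of_forall_mem measurableSet_Icc hqFM)
  · have hsub : uIoc 0 t ⊆ Icc 0 T := by
      rw [uIoc_of_le ht.1]
      exact Ioc_subset_Icc_self.trans (Icc_subset_Icc_right ht.2)
    refine tendsto_nhds_unique (hxlim t ht) ?_
    simp_rw [fun k => (hsolφ k).integral_eq ht]
    refine Tendsto.const_add x₀ ?_
    refine intervalIntegral.tendsto_integral_filter_of_dominated_convergence (fun _ => M)
      (Eventually.of_forall fun k => (hFm k).mono_measure (Measure.restrict_mono hsub le_rfl))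
      (Eventually.of_forall fun k => Eventually.of_forall fun τ hτ => ?_)
      intervalIntegrable_const (Eventually.of_forall fun τ hτ => ?_)
    · exact (hbφ k τ (hsub hτ)).2.2.2
    · exact hFlim τ (hsub hτ)

end CoupledProblem

/-! ### Sample averages -/

theorem timeBox_mono {E Y : Type*} [NormedAddCommGroup E] [NormedAddCommGroup Y] {R R' : ℝ}
    (h : R ≤ R') : timeBox E Y R ⊆ timeBox E Y R' := by
  rintro ⟨t, x, y⟩ hp
  rw [mem_timeBox] at hp ⊢
  exact ⟨⟨hp.1.1, hp.1.2.trans h⟩, hp.2.1.trans h, hp.2.2.trans h⟩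

theorem ae_tendstoUniformlyOn_timeBox_average {Ω Z E Y W : Type*} [MeasurableSpace Ω]
    {P : Measure Ω} [MeasurableSpace Z] {μ : Measure Z} [NormedAddCommGroup E] [ProperSpace E]
    [NormedAddCommGroup Y] [ProperSpace Y] [NormedAddCommGroup W] [NormedSpace ℝ W]
    [CompleteSpace W] [SecondCountableTopology W]
    {sample : ℕ → Ω → Z} (hmeas : ∀ l, Measurable (sample l))
    (hindep : Pairwise fun k l => IndepFun (sample k) (sample l) P)
    (hlaw : ∀ l, P.map (sample l) = μ) {h : ℝ × E × Y → Z → W}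
    (hm : ∀ t x y, 0 ≤ t → AEStronglyMeasurable (h (t, x, y)) μ)
    (hc : ∀ᵐ z ∂μ, ContinuousOn (fun p => h p z) {p | 0 ≤ p.1})
    (hb : ∀ R, ∃ κ : Z → ℝ, Integrable κ μ ∧
      ∀ᵐ z ∂μ, ∀ p ∈ timeBox E Y R, ‖h p z‖ ≤ κ z) :
    (∀ R, ContinuousOn (fun p => ∫ z, h p z ∂μ) (timeBox E Y R)) ∧
    ∀ᵐ ω ∂P, ∀ R, TendstoUniformlyOn
      (fun (ν : ℕ) p => (1 / (ν : ℝ)) • ∑ l ∈ Finset.range ν, h p (sample l ω))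
      (fun p => ∫ z, h p z ∂μ) atTop (timeBox E Y R) := by
  have hR := fun R : ℝ => (hb R).elim fun κ hκ =>
    ae_tendstoUniformlyOn_average hmeas hindep hlaw (isCompact_timeBox R)
      (fun p hp => hm p.1 p.2.1 p.2.2 (mem_timeBox.1 hp).1.1)
      (hc.mono fun z hz => hz.mono fun p hp => (mem_timeBox.1 hp).1.1) hκ.1 hκ.2
  refine ⟨fun R => (hR R).1, ?_⟩
  have hN : ∀ᵐ ω ∂P, ∀ N : ℕ, TendstoUniformlyOn
      (fun (ν : ℕ) p => (1 / (ν : ℝ)) • ∑ l ∈ Finset.range ν, h p (sample l ω))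
      (fun p => ∫ z, h p z ∂μ) atTop (timeBox E Y N) := ae_all_iff.2 fun N => (hR N).2
  filter_upwards [hN] with ω hω R
  obtain ⟨N, hRN⟩ := exists_nat_ge R
  exact (hω N).mono (timeBox_mono hRN)

namespace CoupledData

variable {d : ℕ} {Ξ : Set (Vec d)} {n m q : ℕ}

/-- The expected value problem. -/
noncomputable def meanProblem (D : CoupledData Ξ n m q) (μ : Measure Ξ) :
    CoupledProblem (Vec n) (Vec m) (Fin q) where
  F p := D.meanF μ p.1 p.2.1 p.2.2
  G p := D.meanG μ p.1 p.2.1 p.2.2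
  C i p := (D.meanA μ *ᵥ p.2.1.ofLp) i + (D.meanB μ *ᵥ p.2.2.ofLp) i + D.meanQ μ p.1 i

/-- The sample average approximation built on `s 0, …, s (ν - 1)`. -/
noncomputable def saaProblem (D : CoupledData Ξ n m q) (s : ℕ → Ξ) (ν : ℕ) :
    CoupledProblem (Vec n) (Vec m) (Fin q) where
  F p := D.saaF s ν p.1 p.2.1 p.2.2
  G p := D.saaG s ν p.1 p.2.1 p.2.2
  C i p := (1 / (ν : ℝ)) * ∑ l ∈ Finset.range ν,
    ((D.A (s l) *ᵥ p.2.1.ofLp) i + (D.B (s l) *ᵥ p.2.2.ofLp) i + D.Q p.1 (s l) i)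

/-- The constraints that almost surely do not involve the decision variable. -/
def decisionFree (D : CoupledData Ξ n m q) (μ : Measure Ξ) : Set (Fin q) :=
  {i | ∀ᵐ z ∂μ, ∀ j, D.B z i j = 0}

theorem IsSAASolution.isClassicalSolution {D : CoupledData Ξ n m q} {s : ℕ → Ξ} {ν : ℕ} {T : ℝ}
    {x : ℝ → Vec n} {y : ℝ → Vec m} (h : D.IsSAASolution s ν T x y) (hT : 0 < T) :
    (D.saaProblem s ν).IsClassicalSolution D.x₀ T x y where
  continuousOn := h.continuousOn
  initial := h.initial
  hasDerivWithinAt := h.deriv_eq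
  continuousOn_rhs := by
    have huniq := uniqueDiffOn_Icc hT
    exact (h.contDiffOn.continuousOn_derivWithin huniq le_rfl).congr fun t ht =>
      ((h.deriv_eq t ht).derivWithin (huniq t ht)).symm
  optimal := h.optimal

section Integrands

variable {D : CoupledData Ξ n m q} {μ : Measure Ξ}

theorem StandingAssumptions.ae_continuousOn_f (hD : D.StandingAssumptions μ) :
    ∀ᵐ z ∂μ, ContinuousOn (fun p : ℝ × Vec n × Vec m => D.f p.1 p.2.1 p.2.2 z) {p | 0 ≤ p.1} := by
  obtain ⟨κ, hκ0, -, hκ⟩ := hD.lipschitz_f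
  filter_upwards [hκ] with z hz p hp
  rw [ContinuousWithinAt, tendsto_iff_norm_sub_tendsto_zero]
  have hlim : Tendsto (fun p' : ℝ × Vec n × Vec m =>
      κ z * (|p'.1 - p.1| + ‖p'.2.1 - p.2.1‖ + ‖p'.2.2 - p.2.2‖)) (𝓝[{p | 0 ≤ p.1}] p) (𝓝 0) := by
    have : Continuous fun p' : ℝ × Vec n × Vec m =>
      κ z * (|p'.1 - p.1| + ‖p'.2.1 - p.2.1‖ + ‖p'.2.2 - p.2.2‖) := by fun_prop
    simpa using (this.tendsto p).mono_left nhdsWithin_le_nhds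
  refine squeeze_zero' (Eventually.of_forall fun _ => norm_nonneg _) ?_ hlim
  filter_upwards [self_mem_nhdsWithin] with p' hp'
  exact hz _ _ _ _ _ _ hp' hp

theorem StandingAssumptions.dominated_f (hD : D.StandingAssumptions μ) (R : ℝ) :
    ∃ κ : Ξ → ℝ, Integrable κ μ ∧ ∀ᵐ z ∂μ, ∀ p ∈ timeBox (Vec n) (Vec m) R,
      ‖D.f p.1 p.2.1 p.2.2 z‖ ≤ κ z := by
  obtain ⟨κ, hκ0, hκi, hκ⟩ := hD.lipschitz_f
  refine ⟨fun z => ‖D.f 0 0 0 z‖ + κ z * (R + R + R),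
    (hD.integrable_f 0 0 0 le_rfl).norm.add (hκi.mul_const _), ?_⟩
  filter_upwards [hκ] with z hz
  rintro ⟨t, x, y⟩ hp
  rw [mem_timeBox] at hp
  have h1 := hz t 0 x 0 y 0 hp.1.1 le_rfl
  have h2 := norm_le_norm_add_norm_sub' (D.f t x y z) (D.f 0 0 0 z)
  have h3 : κ z * (|t - 0| + ‖x - 0‖ + ‖y - 0‖) ≤ κ z * (R + R + R) := by
    refine mul_le_mul_of_nonneg_left ?_ (hκ0 z)
    rw [sub_zero, sub_zero, sub_zero, abs_of_nonneg hp.1.1]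
    linarith [hp.1.2, hp.2.1, hp.2.2]
  exact h2.trans (by gcongr; exact h1.trans h3)

theorem StandingAssumptions.integrable_mulVec_A (hD : D.StandingAssumptions μ) (i : Fin q)
    (x : Vec n) : Integrable (fun z => (D.A z *ᵥ x.ofLp) i) μ := by
  simp only [Matrix.mulVec, dotProduct]
  exact integrable_finsetSum _ fun j _ => (hD.integrable_A i j).mul_const _

theorem StandingAssumptions.integrable_mulVec_B (hD : D.StandingAssumptions μ) (i : Fin q)
    (y : Vec m) : Integrable (fun z => (D.B z *ᵥ y.ofLp) i) μ := by
  simp only [Matrix.mulVec, dotProduct]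
  exact integrable_finsetSum _ fun j _ => (hD.integrable_B i j).mul_const _

theorem StandingAssumptions.integrable_Q_apply (hD : D.StandingAssumptions μ) (i : Fin q)
    {t : ℝ} (ht : 0 ≤ t) : Integrable (fun z => D.Q t z i) μ :=
  (EuclideanSpace.proj (𝕜 := ℝ) i).integrable_comp (hD.integrable_Q t ht)

theorem StandingAssumptions.integral_constraint (hD : D.StandingAssumptions μ) (i : Fin q)
    {t : ℝ} (ht : 0 ≤ t) (x : Vec n) (y : Vec m) :
    ∫ z, ((D.A z *ᵥ x.ofLp) i + (D.B z *ᵥ y.ofLp) i + D.Q t z i) ∂μ =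
      (D.meanProblem μ).C i (t, x, y) := by
  have hA := hD.integrable_mulVec_A i x
  have hB := hD.integrable_mulVec_B i y
  have hAB : Integrable (fun z => (D.A z *ᵥ x.ofLp) i + (D.B z *ᵥ y.ofLp) i) μ := hA.add hB
  rw [integral_add hAB (hD.integrable_Q_apply i ht), integral_add hA hB]
  have hQ : ∫ z, D.Q t z i ∂μ = D.meanQ μ t i :=
    (EuclideanSpace.proj (𝕜 := ℝ) i).integral_comp_comm (hD.integrable_Q t ht)
  rw [hQ]
  simp only [meanProblem, Matrix.mulVec, dotProduct, meanA, meanB, Matrix.of_apply]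
  rw [integral_finsetSum _ fun j _ => (hD.integrable_A i j).mul_const _,
    integral_finsetSum _ fun j _ => (hD.integrable_B i j).mul_const _]
  simp_rw [integral_mul_const]

theorem abs_mulVec_le {ι : Type*} {k : ℕ} (A : Matrix ι (Fin k) ℝ) (i : ι) {v : Vec k} {R : ℝ}
    (hv : ‖v‖ ≤ R) : |(A *ᵥ v.ofLp) i| ≤ ∑ j, |A i j| * R := by
  simp only [Matrix.mulVec, dotProduct]
  refine (Finset.abs_sum_le_sum_abs _ _).trans (Finset.sum_le_sum fun j _ => ?_)
  rw [abs_mul]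
  gcongr
  exact (PiLp.norm_apply_le v j).trans hv

theorem StandingAssumptions.dominated_constraint (hD : D.StandingAssumptions μ) (i : Fin q)
    (R : ℝ) : ∃ κ : Ξ → ℝ, Integrable κ μ ∧ ∀ᵐ z ∂μ, ∀ p ∈ timeBox (Vec n) (Vec m) R,
      ‖(D.A z *ᵥ p.2.1.ofLp) i + (D.B z *ᵥ p.2.2.ofLp) i + D.Q p.1 z i‖ ≤ κ z := by
  obtain ⟨κ, hκ0, hκi, hκ⟩ := hD.bound_Q
  refine ⟨fun z => ∑ j, |D.A z i j| * R + ∑ j, |D.B z i j| * R + κ z * R,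
    ((integrable_finsetSum _ fun j _ => (hD.integrable_A i j).abs.mul_const _).add
      (integrable_finsetSum _ fun j _ => (hD.integrable_B i j).abs.mul_const _)).add
      (hκi.mul_const _), ?_⟩
  filter_upwards [hκ] with z hz
  rintro ⟨t, x, y⟩ hp
  rw [mem_timeBox] at hp
  have hQ : ‖D.Q t z i‖ ≤ κ z * R := (PiLp.norm_apply_le _ _).trans
    ((hz t hp.1.1).trans (mul_le_mul_of_nonneg_left hp.1.2 (hκ0 z)))
  exact (norm_add₃_le).trans (add_le_add (add_le_add (abs_mulVec_le _ _ hp.2.1)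
    (abs_mulVec_le _ _ hp.2.2)) hQ)

theorem StandingAssumptions.ae_continuous_constraint (hD : D.StandingAssumptions μ) (i : Fin q) :
    ∀ᵐ z ∂μ, Continuous fun p : ℝ × Vec n × Vec m =>
      (D.A z *ᵥ p.2.1.ofLp) i + (D.B z *ᵥ p.2.2.ofLp) i + D.Q p.1 z i := by
  filter_upwards [hD.continuous_Q] with z hz
  have : Continuous fun p : ℝ × Vec n × Vec m => D.Q p.1 z i :=
    (EuclideanSpace.proj (𝕜 := ℝ) i).continuous.comp (hz.comp continuous_fst)
  simp only [Matrix.mulVec, dotProduct]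
  fun_prop

/-- By continuity of `g` in `(t, x)`, the exceptional null set in the strong convexity of the
objective can be chosen independent of `(t, x)`. -/
theorem StronglyConvexObjective.exists_modulus (hconv : D.StronglyConvexObjective μ)
    (hD : D.StandingAssumptions μ) :
    ∃ ϱ : Ξ → ℝ, (∀ z, 0 < ϱ z) ∧ Integrable ϱ μ ∧
      ∀ᵐ z ∂μ, ∀ t x, 0 ≤ t → StrongConvexOn univ (ϱ z) fun y => D.g t x y z := by
  obtain ⟨ϱ, hϱ0, hϱi, hϱ⟩ := hconv
  refine ⟨ϱ, hϱ0, hϱi, ?_⟩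
  let u : ℕ → NNReal × Vec n := TopologicalSpace.denseSeq _
  have hu : DenseRange u := TopologicalSpace.denseRange_denseSeq _
  have hdense := ae_all_iff.2 fun k => hϱ (u k).1 (u k).2 (u k).1.2
  filter_upwards [hdense, hD.continuous_g] with z hz hcont t x ht
  refine ⟨convex_univ, fun y₁ _ y₂ _ a b ha hb hab => ?_⟩
  obtain rfl : a = 1 - b := by linarith
  rcases hb.eq_or_lt with rfl | hb
  · simp
  rcases ha.eq_or_lt with ha' | ha
  · obtain rfl : b = 1 := by linarith
    simp
  -- both sides of the inequality are continuous in `(t, x)`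
  have key : ∀ p : NNReal × Vec n, D.g p.1 p.2 ((1 - b) • y₁ + b • y₂) z ≤
      (1 - b) * D.g p.1 p.2 y₁ z + b * D.g p.1 p.2 y₂ z
        - 1 / 2 * ϱ z * b * (1 - b) * ‖y₁ - y₂‖ ^ 2 := by
    intro p
    have hg : ∀ y : Vec m, Continuous fun p : NNReal × Vec n => D.g p.1 p.2 y z := fun y =>
      hcont.comp (f := fun p : NNReal × Vec n => ((p.1 : ℝ), p.2, y)) (by fun_prop)
    refine hu.induction_on p (isClosed_le (hg _) ?_) fun k => hz k y₁ y₂ b hb (by linarith)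
    exact (((hg y₁).const_mul _).add ((hg y₂).const_mul _)).sub continuous_const
  lift t to NNReal using ht
  refine (key (t, x)).trans_eq ?_
  simp only [smul_eq_mul]
  ring

theorem strongConvexOn_saaG {s : ℕ → Ξ} {ϱ : Ξ → ℝ} {t : ℝ} {x : Vec n}
    (h : ∀ l, StrongConvexOn univ (ϱ (s l)) fun y => D.g t x y (s l)) (ν : ℕ) :
    StrongConvexOn univ ((1 / (ν : ℝ)) * ∑ l ∈ Finset.range ν, ϱ (s l))
      fun y => D.saaG s ν t x y := by
  refine ⟨convex_univ, fun y₁ _ y₂ _ a b ha hb hab => ?_⟩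
  have hsum := Finset.sum_le_sum fun l (_ : l ∈ Finset.range ν) =>
    (h l).2 (mem_univ y₁) (mem_univ y₂) ha hb hab
  refine (mul_le_mul_of_nonneg_left hsum (by positivity : (0 : ℝ) ≤ 1 / ν)).trans_eq ?_
  simp only [smul_eq_mul, saaG, Finset.sum_sub_distrib, Finset.sum_add_distrib, ← Finset.mul_sum,
    ← Finset.sum_mul, ← Finset.sum_div]
  ring

end Integrands

/-- Under nondegeneracy, an interior point of `K(0, x₀)` satisfies strictly every constraint whose
coefficients of the decision variable do not vanish almost surely. -/
theorem slater_of_mem_interior {D : CoupledData Ξ n m q} {μ : Measure Ξ}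
    (hnondeg : D.NondegenerateConstraints μ) {y₀ : Vec m}
    (hy₀ : y₀ ∈ interior (D.K μ 0 D.x₀)) {i : Fin q} (hi : i ∉ D.decisionFree μ) :
    (D.meanProblem μ).C i (0, D.x₀, y₀) < 0 := by
  have hK := interior_subset hy₀ i
  by_cases hB : ∀ j, D.meanB μ i j = 0
  · refine lt_of_le_of_ne hK fun h => hi (hnondeg i hB ?_)
    have h0 : (D.meanB μ *ᵥ y₀.ofLp) i = 0 := by simp [Matrix.mulVec, dotProduct, hB]
    simpa [meanProblem, h0] using h
  -- a small step along the `i`-th row increases the `i`-th constraint but stays in the interior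
  let w : Vec m := WithLp.toLp 2 (D.meanB μ i)
  have hw : 0 < (D.meanB μ *ᵥ w.ofLp) i := by
    have h1 : (D.meanB μ *ᵥ w.ofLp) i = ∑ j, D.meanB μ i j * D.meanB μ i j := rfl
    rw [h1]
    push Not at hB
    obtain ⟨j, hj⟩ := hB
    exact Finset.sum_pos' (fun j _ => mul_self_nonneg _)
      ⟨j, Finset.mem_univ _, mul_self_pos.2 hj⟩
  have hcont : Continuous fun ε : ℝ => y₀ + ε • w := by fun_prop
  have hev : ∀ᶠ ε : ℝ in 𝓝[>] 0, y₀ + ε • w ∈ interior (D.K μ 0 D.x₀) :=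
    nhdsWithin_le_nhds (hcont.continuousAt.preimage_mem_nhds
      (by simpa using isOpen_interior.mem_nhds hy₀))
  obtain ⟨ε, hε, hε0⟩ := (hev.and self_mem_nhdsWithin).exists
  have h1 := interior_subset hε i
  rw [WithLp.ofLp_add, WithLp.ofLp_smul, Matrix.mulVec_add, Matrix.mulVec_smul] at h1
  simp only [Pi.add_apply, Pi.smul_apply, smul_eq_mul] at h1
  have h2 := mul_pos (show 0 < ε from hε0) hw
  simp only [meanProblem]
  linarith

section Sampling

variable {D : CoupledData Ξ n m q} {μ : Measure Ξ} {Ω : Type*} [MeasurableSpace Ω]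
  {P : Measure Ω} {sample : ℕ → Ω → Ξ}

theorem StandingAssumptions.isRegular_and_ae_approximates [IsProbabilityMeasure μ]
    (hD : D.StandingAssumptions μ) (hconv : D.StronglyConvexObjective μ)
    (hnondeg : D.NondegenerateConstraints μ) {y₀ : Vec m}
    (hy₀ : y₀ ∈ interior (D.K μ 0 D.x₀)) (hmeas : ∀ l, Measurable (sample l))
    (hindep : Pairwise fun k l => IndepFun (sample k) (sample l) P)
    (hlaw : ∀ l, P.map (sample l) = μ) :
    (D.meanProblem μ).IsRegular D.x₀ y₀ (D.decisionFree μ) ∧ ∃ ρ > 0, ∀ᵐ ω ∂P,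
      CoupledProblem.Approximates (D.saaProblem fun l => sample l ω) (D.meanProblem μ)
        (D.decisionFree μ) ρ := by
  obtain ⟨hFc, hF⟩ := ae_tendstoUniformlyOn_timeBox_average hmeas hindep hlaw
    (h := fun (p : ℝ × Vec n × Vec m) z => D.f p.1 p.2.1 p.2.2 z)
    (fun t x y ht => (hD.integrable_f t x y ht).aestronglyMeasurable) hD.ae_continuousOn_f
    hD.dominated_f
  obtain ⟨hGc, hG⟩ := ae_tendstoUniformlyOn_timeBox_average hmeas hindep hlaw
    (h := fun (p : ℝ × Vec n × Vec m) z => D.g p.1 p.2.1 p.2.2 z)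
    (fun t x y ht => (hD.integrable_g t x y ht).aestronglyMeasurable)
    (hD.continuous_g.mono fun z hz => hz.continuousOn)
    (fun R => (hD.dominated_g R).imp fun κ hκ => ⟨hκ.1, hκ.2.mono fun z hz p hp =>
      hz _ _ _ (mem_timeBox.1 hp).1.1 (mem_timeBox.1 hp).1.2 (mem_timeBox.1 hp).2.1
        (mem_timeBox.1 hp).2.2⟩)
  have hC' := fun i => ae_tendstoUniformlyOn_timeBox_average hmeas hindep hlaw
    (h := fun (p : ℝ × Vec n × Vec m) z =>
      (D.A z *ᵥ p.2.1.ofLp) i + (D.B z *ᵥ p.2.2.ofLp) i + D.Q p.1 z i)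
    (fun t x y ht => (((hD.integrable_mulVec_A i x).add (hD.integrable_mulVec_B i y)).add
      (hD.integrable_Q_apply i ht)).aestronglyMeasurable)
    ((hD.ae_continuous_constraint i).mono fun z hz => hz.continuousOn)
    (hD.dominated_constraint i)
  have hCeq : ∀ i R, EqOn (fun p : ℝ × Vec n × Vec m =>
      ∫ z, ((D.A z *ᵥ p.2.1.ofLp) i + (D.B z *ᵥ p.2.2.ofLp) i + D.Q p.1 z i) ∂μ)
      ((D.meanProblem μ).C i) (timeBox _ _ R) := fun i R p hp =>
    hD.integral_constraint i (mem_timeBox.1 hp).1.1 _ _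
  have hC := ae_all_iff.2 fun i => (hC' i).2
  obtain ⟨ϱ, hϱ0, hϱi, hϱ⟩ := hconv.exists_modulus hD
  have hρ : 0 < ∫ z, ϱ z ∂μ := by
    rw [integral_pos_iff_support_of_nonneg (fun z => (hϱ0 z).le) hϱi]
    have : Function.support ϱ = univ := by
      ext z
      simpa using (hϱ0 z).ne'
    simp [this]
  have hϱlim := (ae_tendstoUniformlyOn_average hmeas hindep hlaw (isCompact_univ (X := Unit))
    (h := fun _ => ϱ) (fun _ _ => hϱi.aestronglyMeasurable)
    (Eventually.of_forall fun _ => continuousOn_const) hϱi.norm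
    (Eventually.of_forall fun _ _ _ => le_rfl)).2
  have hsample : ∀ {p : Ξ → Prop}, (∀ᵐ z ∂μ, p z) → ∀ᵐ ω ∂P, ∀ l, p (sample l ω) := by
    intro p hp
    exact ae_all_iff.2 fun l => ae_of_ae_map (hmeas l).aemeasurable (by rwa [hlaw])
  have hfree : ∀ᵐ z ∂μ, ∀ i, i ∈ D.decisionFree μ → ∀ j, D.B z i j = 0 := by
    refine ae_all_iff.2 fun i => ?_
    by_cases hi : i ∈ D.decisionFree μ
    · filter_upwards [hi] with z hz _ using hz
    · exact Eventually.of_forall fun _ h => absurd h hi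
  refine ⟨?_, (∫ z, ϱ z ∂μ) / 2, half_pos hρ, ?_⟩
  · exact
      { continuousOn_F := hFc
        continuousOn_G := hGc
        continuousOn_C := fun i R => ((hC' i).1 R).congr fun p hp => (hCeq i R hp).symm
        convexOn_C := by
          intro i t x _
          refine ⟨convex_univ, fun y₁ _ y₂ _ a b _ _ hab => le_of_eq ?_⟩
          obtain rfl : a = 1 - b := by linarith
          simp only [meanProblem, WithLp.ofLp_add, WithLp.ofLp_smul, Matrix.mulVec_add,
            Matrix.mulVec_smul, Pi.add_apply, Pi.smul_apply, smul_eq_mul]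
          ring
        slater := fun i hi => slater_of_mem_interior hnondeg hy₀ hi }
  · filter_upwards [hF, hG, hC, hϱlim, hsample hϱ, hsample hfree] with ω hFω hGω hCω hϱω hcω hfω
    exact
      { tendsto_F := hFω
        tendsto_G := hGω
        tendsto_C := fun i R => (hCω i R).congr_right (hCeq i R)
        strongConvexOn := by
          filter_upwards [(hϱω.tendsto_at (mem_univ ())).eventually_const_lt (half_lt_self hρ)]
            with ν hν t x ht
          exact (strongConvexOn_saaG (fun l => hcω l t x ht) ν).mono hν.le
        indep := by
          refine Eventually.of_forall fun ν i hi t x y y' => ?_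
          have h0 : ∀ l (v : Vec m), (D.B (sample l ω) *ᵥ v.ofLp) i = 0 := fun l v => by
            simp [Matrix.mulVec, dotProduct, hfω l i hi]
          simp only [saaProblem, h0] }

end Sampling

end CoupledData

theorem mainTheorem6 {d n m q : ℕ}
    {Ω : Type*} [MeasurableSpace Ω] (P : Measure Ω) [IsProbabilityMeasure P]
    (Ξ : Set (Vec d)) (ξ : Ω → Ξ) (hξ : Measurable ξ)
    (D : CoupledData Ξ n m q)
    (hD : D.StandingAssumptions (P.map ξ))
    (hconv : D.StronglyConvexObjective (P.map ξ))
    (hint : (interior (D.K (P.map ξ) 0 D.x₀)).Nonempty)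
    (hnondeg : D.NondegenerateConstraints (P.map ξ))
    -- the independent identically distributed sample
    (sample : ℕ → Ω → Ξ) (hmeas : ∀ l, Measurable (sample l))
    (hindep : iIndepFun sample P) (hident : ∀ l, IdentDistrib (sample l) ξ P P)
    -- solutions of the sample average approximation problems, for sufficiently large `ν`
    (Tstar : ℝ) (hT : 0 < Tstar)
    (x : ℕ → Ω → ℝ → Vec n) (y : ℕ → Ω → ℝ → Vec m)
    (hsol : ∀ᵐ ω ∂P, ∀ᶠ ν in atTop,
      D.IsSAASolution (fun l => sample l ω) ν Tstar (x ν ω) (y ν ω)) :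
    ∃ Tbar : ℝ, 0 < Tbar ∧ Tbar ≤ Tstar ∧
      ∀ᵐ ω ∂P, ∃ (ν : ℕ → ℕ) (xs : ℝ → Vec n) (ys : ℝ → Vec m),
        StrictMono ν ∧
        TendstoUniformlyOn (fun k => x (ν k) ω) xs atTop (Icc 0 Tbar) ∧
        MemLp ys 2 (volume.restrict (Icc 0 Tbar)) ∧
        Tendsto (fun k => eLpNorm (y (ν k) ω - ys) 2 (volume.restrict (Icc 0 Tbar)))
          atTop (𝓝 0) ∧
        D.IsWeakSolution (P.map ξ) Tbar xs ys := by
  have : IsProbabilityMeasure (P.map ξ) := Measure.isProbabilityMeasure_map hξ.aemeasurable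
  obtain ⟨y₀, hy₀⟩ := hint
  obtain ⟨hreg, ρ, hρ, happ⟩ := hD.isRegular_and_ae_approximates hconv hnondeg hy₀ hmeas
    (fun k l hkl => hindep.indepFun hkl) fun l => (hident l).map_eq
  obtain ⟨Tb, δ, R, M, hTb, hTbT, hM, hslater, hbound⟩ := hreg.exists_apriori_bound hρ hT
  refine ⟨Tb, hTb, hTbT, ?_⟩
  filter_upwards [happ, hsol] with ω hω hsolω
  have hcl : ∀ᶠ ν in atTop, (D.saaProblem (fun l => sample l ω) ν).IsClassicalSolution D.x₀ Tstar
      (x ν ω) (y ν ω) := hsolω.mono fun ν h => h.isClassicalSolution hT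
  obtain ⟨ν, xs, ys, hν, hxs, hys2, hysl, hlip, hopt, hint, heq⟩ :=
    hω.exists_subseq_tendsto_weakSolution hreg hρ (x := fun ν => x ν ω) (y := fun ν => y ν ω)
      hM hslater (hcl.mono fun ν h => h.mono hTbT)
      (by filter_upwards [hbound _ hω, hcl] with ν h1 h2 using h1 _ _ h2)
  refine ⟨ν, xs, ys, hν, hxs, hys2, hysl, ?_⟩
  exact
    { absolutelyContinuous := by
        rw [← uIcc_of_le hTb.le] at hlip
        exact hlip.absolutelyContinuousOnInterval
      integrable := hys2.integrable one_le_two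
      optimal := hopt
      integrable_rhs := hint
      integral_eq := heq }
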